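/- A Petri net is a tuple $\mathcal N=(P,T,\mathit{Pre},\mathit{Post})$ with finite sets $P$ of places and $T$ of transitions and matrices $\mathit{Pre},\mathit{Post}\in\mathbb N^{P\times T}$. A marking is a vector $M\in\mathbb N^P$, and $\|M\|=\sum_{p}M(p)$. Firing $t\in T$ leads from $M$ to $M'$ if for all $p \in P$, $M(p)\ge \mathit{Pre}[p,t]$ and $M'(p)=M(p)+\mathit{Post}[p,t]-\mathit{Pre}[p,t]$; $M\xrightarrow{*}M'$ means that some finite sequence of firings leads from $M$ to $M'$. A Petri net system is a triple $(\mathcal N,M,M')$ with markings $M\ne M'$ of $\mathcal N$; a number $B\in\mathbb N$ is a cut-off for it if $n\cdot M\xrightarrow{*}n\cdot M'$ for every $n\ge B$. The size $|\mathcal N|$ is the number of bits of the encoding of $\mathcal N$ that lists $|P|$ and $|T|$ in unary and the entries of $\mathit{Pre}$ and $\mathit{Post}$ in (self-delimiting) binary. A rendez-vous protocol is a tuple $\mathcal P=(Q,\Sigma,\mathit{init},\mathit{fin},R)$ with finite sets $Q$ of states and $\Sigma$ of letters, $\mathit{init},\mathit{fin}\in Q$, and a set of rules $R\subseteq Q\times\{!a,?a: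 a\in\Sigma\}\times Q$. A configuration is a multiset of states. There is a step from $C$ to $C'$ if there are rules $(p,!a,p'),(q,?a,q')\in R$ such that $C$ contains the multiset $\{p,q\}$ and $C'=C-\{p,q\}+\{p',q'\}$. A number $B\in\mathbb N$ is a cut-off for $\mathcal P$ if for every $n\ge B$ the configuration with $n$ agents, all in state $\mathit{fin}$, can be reached by finitely many steps from the configuration with $n$ agents, all in state $\mathit{init}$. The size of $\mathcal P$ is the number of bits of the encoding that lists $|Q|$ and $|\Sigma|$ in unary, followed by $\mathit{init}$, $\mathit{fin}$ and the rules, with states and letters given by fixed-length binary indices. For $x\in\mathbb N$ let $\mathrm{bits}(x)=\lceil\log_2(x+1)\rceil$ be the number of binary digits of $x$ (so $\mathrm{bits}(0)=0$). **Corollary.** (1) There is a polynomial $f$ such that every Petri net system $(\mathcal N,M,M')$ that admits a cut-off admits a cut-off $B$ with $$\mathrm{bits}(B)\;\le\; f\bigl(|\mathcal N|\,(\mathrm{bits}(\|M\|)+\mathrm{bits}(\|M'\|))\bigr).$$ (2) There is a constant $k$ such that every rendez-vous protocol of size $n$ that admits a cut-off admits a cut-off $B\le 2^{n^{k}}$.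 -/

import Mathlib

/-! ### Petri nets -/

/-- A Petri net with set of places `P` and set of transitions `T` (both finite whenever the net is
used); rows of the two matrices are indexed by places, columns by transitions. -/
structure PetriNet (P T : Type*) where
  Pre : Matrix P T ℕ
  Post : Matrix P T ℕ

namespace PetriNet

variable {P T : Type*}

/-- The incidence matrix `Post - Pre`, with integer entries. -/
def incidence (N : PetriNet P T) : Matrix P T ℤ :=
  fun p t => (N.Post p t : ℤ) - (N.Pre p t : ℤ)

/-- `N.Fires t M M'`: the marking `M'` is reached from the marking `M` by firing `t`. -/
def Fires (N : PetriNet P T) (t : T) (M M' : P → ℕ) : Prop :=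
  ∀ p, N.Pre p t ≤ M p ∧ (M' p : ℤ) = (M p : ℤ) + N.incidence p t

/-- `N.FiresSeq σ M M'`: the firing sequence `σ` leads from `M` to `M'`. -/
def FiresSeq (N : PetriNet P T) : List T → (P → ℕ) → (P → ℕ) → Prop
  | [], M, M' => M = M'
  | t :: σ, M, M' => ∃ L, N.Fires t M L ∧ N.FiresSeq σ L M'

/-- `M'` is reachable from `M`. -/
def Reaches (N : PetriNet P T) (M M' : P → ℕ) : Prop :=
  ∃ σ : List T, N.FiresSeq σ M M'

end PetriNet

/-- The size `‖M‖` of a marking: its total number of tokens. -/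
def markingSize {P : Type*} [Fintype P] (M : P → ℕ) : ℕ := ∑ p, M p

/-- A Petri net system: a net together with two distinct markings. -/
structure PetriNetSystem (P T : Type*) where
  net : PetriNet P T
  source : P → ℕ
  target : P → ℕ
  source_ne_target : source ≠ target

/-- `B` is a cut-off for the system `(N, M, M')`: from `n • M` one can reach `n • M'` for all
`n ≥ B`. -/
def PetriNetSystem.IsCutoff {P T : Type*} (S : PetriNetSystem P T) (B : ℕ) : Prop :=
  ∀ n : ℕ, B ≤ n → S.net.Reaches (n • S.source) (n • S.target)

/-- The system admits a cut-off. -/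
def PetriNetSystem.AdmitsCutoff {P T : Type*} (S : PetriNetSystem P T) : Prop :=
  ∃ B : ℕ, S.IsCutoff B

/-! ### Rendez-vous protocols -/

/-- The actions `!a` (send) and `?a` (receive) over a communication alphabet. -/
inductive RVAction (A : Type*) where
  | send (a : A)
  | recv (a : A)

/-- A rendez-vous protocol with set of states `Q` and communication alphabet `A` (both finite
whenever the protocol is used). -/
structure RVProtocol (Q A : Type*) where
  init : Q
  fin : Q
  rules : Finset (Q × RVAction A × Q)

namespace RVProtocol

variable {Q A : Type*}

open Classical in
/-- One rendez-vous `C ⇒ C'` between two agents; configurations are multisets of states, given by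
their multiplicity functions `Q → ℕ`. -/
def Step (V : RVProtocol Q A) (C C' : Q → ℕ) : Prop :=
  ∃ (a : A) (p q p' q' : Q),
    (p, RVAction.send a, p') ∈ V.rules ∧ (q, RVAction.recv a, q') ∈ V.rules ∧
    (Pi.single p 1 + Pi.single q 1 : Q → ℕ) ≤ C ∧
    C' = C - (Pi.single p 1 + Pi.single q 1) + (Pi.single p' 1 + Pi.single q' 1)

/-- The reflexive and transitive closure of `⇒`. -/
def Reaches (V : RVProtocol Q A) : (Q → ℕ) → (Q → ℕ) → Prop :=
  Relation.ReflTransGen V.Step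

open Classical in
/-- The configuration with `n` agents in the initial state and no other agents. -/
noncomputable def initConfig (V : RVProtocol Q A) (n : ℕ) : Q → ℕ := Pi.single V.init n

open Classical in
/-- The configuration with `n` agents in the final state and no other agents. -/
noncomputable def finConfig (V : RVProtocol Q A) (n : ℕ) : Q → ℕ := Pi.single V.fin n

/-- `B` is a cut-off for the protocol. -/
def IsCutoff (V : RVProtocol Q A) (B : ℕ) : Prop :=
  ∀ n : ℕ, B ≤ n → V.Reaches (V.initConfig n) (V.finConfig n)

/-- The protocol admits a cut-off. -/
def AdmitsCutoff (V : RVProtocol Q A) : Prop :=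
  ∃ B : ℕ, V.IsCutoff B

end RVProtocol

/-! ### Binary encodings and sizes -/

/-- The number `n` in unary, closed by an end marker. -/
def unaryCode (n : ℕ) : List Bool := List.replicate n true ++ [false]

/-- The number `n` in binary, in a self-delimiting way: every binary digit is preceded by the
marker `true`, and the marker `false` ends the code. -/
def binaryCode (n : ℕ) : List Bool := n.bits.flatMap (fun b => [true, b]) ++ [false]

/-- An element of a finite set as its index in an enumeration of the set, written in binary with a
fixed number of digits that depends only on the number of elements of the set. -/
noncomputable def elementCode {X : Type*} [Fintype X] (x : X) : List Bool :=
  List.ofFn fun j : Fin (Fintype.card X).size => (Fintype.equivFin X x : ℕ).testBit j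

/-- A matrix of natural numbers, entry by entry, all entries in binary. -/
noncomputable def matrixCode {P T : Type*} [Fintype P] [Fintype T] (B : Matrix P T ℕ) :
    List Bool :=
  (List.ofFn fun i : Fin (Fintype.card P) =>
    (List.ofFn fun j : Fin (Fintype.card T) =>
      binaryCode (B ((Fintype.equivFin P).symm i) ((Fintype.equivFin T).symm j))).flatten).flatten

/-- The encoding of a Petri net: the numbers of places and of transitions, then the matrices `Pre`
and `Post`. -/
noncomputable def PetriNet.encode {P T : Type*} [Fintype P] [Fintype T] (N : PetriNet P T) :
    List Bool :=
  unaryCode (Fintype.card P) ++ unaryCode (Fintype.card T) ++ matrixCode N.Pre ++ matrixCode N.Post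

/-- The size `|N|` of a Petri net: the number of bits of its encoding. It does not depend on the
enumerations of the places and transitions. -/
noncomputable def PetriNet.size {P T : Type*} [Fintype P] [Fintype T] (N : PetriNet P T) : ℕ :=
  N.encode.length

/-- A rule `(p, !a, q)` or `(p, ?a, q)`: the state `p`, one bit for the kind of the action, the
letter `a`, the state `q`. -/
noncomputable def ruleCode {Q A : Type*} [Fintype Q] [Fintype A] :
    Q × RVAction A × Q → List Bool
  | (p, RVAction.send a, q) => elementCode p ++ [true] ++ elementCode a ++ elementCode q
  | (p, RVAction.recv a, q) => elementCode p ++ [false] ++ elementCode a ++ elementCode q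

/-- The encoding of a rendez-vous protocol: the numbers of states and of letters, the initial and
the final state, and the list of the rules. -/
noncomputable def RVProtocol.encode {Q A : Type*} [Fintype Q] [Fintype A] (V : RVProtocol Q A) :
    List Bool :=
  unaryCode (Fintype.card Q) ++ unaryCode (Fintype.card A) ++
    elementCode V.init ++ elementCode V.fin ++ V.rules.toList.flatMap ruleCode

/-- The size of a rendez-vous protocol: the number of bits of its encoding. It does not depend on
the enumerations of the states, letters and rules. -/
noncomputable def RVProtocol.size {Q A : Type*} [Fintype Q] [Fintype A] (V : RVProtocol Q A) : ℕ :=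
  V.encode.length

/-- The parameter `|N| (log ‖M‖ + log ‖M'‖)` of a Petri net system `(N, M, M')`, where the
logarithm of a natural number is the number of its binary digits (`Nat.size`). -/
noncomputable def PetriNetSystem.param {P T : Type*} [Fintype P] [Fintype T]
    (S : PetriNetSystem P T) : ℕ :=
  S.net.size * ((markingSize S.source).size + (markingSize S.target).size)

/-! ### Small integer vectors in the kernel of an integer matrix -/

/-! A cut-off yields runs from `B • M` to `B • M'` and from `(B + 1) • M` to `(B + 1) • M'`.
Concatenated, they form a run `σ` between positive multiples of `M` and `M'`. The difference of
their transition counts is an integer solution, supported on `σ`, of the marking equation for `M' -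
M`. These two facts already suffice to build a small cut-off.

Siegel's lemma replaces the counts of `σ` by a small vector `v` with the same support that solves
the equation for `d • (M' - M)`. It also replaces the integer solution by a small `y`. Only the
support of `σ` matters for `FiresSeq.exists_marked`: a multiple of `M` with singly exponential
factor can mark every place adjacent to `σ`, and the same holds backwards from `M'` in the reversed
net. Combining both ends with a large multiple of `v` gives `X` reachable from `m₀ • M` and `X'`
leading to `m₀ • M'`, where `X' - X` is the effect of a vector `z` that is positive on all of `σ`.

For large `n = m * m₀ + r`, many copies of `X` are turned into copies of `X'` by firing `z`
repeatedly, with enough tokens always present. The remainder `r` is handled by `r • y`, whose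
negative entries are absorbed by the last copies of `z` (`isCutoff_of_solution`). All quantities are
powers of some `E = 2 ^ poly`. Protocols reduce to nets whose transitions are pairs of matching
rules. -/

theorem exists_small_int_kernel {κ ι : Type*} [Fintype ι] (C : κ → ι → ℤ) (a : ℕ) (ha : 1 ≤ a)
    (hC : ∀ i j, |C i j| ≤ a) (x : ι → ℚ) (hx : x ≠ 0)
    (hCx : ∀ i, ∑ j, (C i j : ℚ) * x j = 0) :
    ∃ t : ι → ℤ, t ≠ 0 ∧ (∀ i, ∑ j, C i j * t j = 0) ∧
      ∀ j, |t j| ≤ ((Fintype.card ι * a) ^ Fintype.card ι : ℕ) := by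
  classical
  set n := Fintype.card ι with hn
  have hn1 : 1 ≤ n := by
    obtain ⟨j, -⟩ := Function.ne_iff.mp hx
    exact Fintype.card_pos_iff.mpr ⟨j⟩
  let row : κ → ι → ℚ := fun i j => C i j
  -- There may be infinitely many rows. A basis of the row space chosen among them has the same
  -- kernel, and has fewer than `n` elements because `x` is a nonzero kernel vector; this leaves an
  -- underdetermined system for Siegel's lemma.
  obtain ⟨f, hf, hspan, -⟩ := Submodule.exists_fun_fin_finrank_span_eq ℚ (Set.range row)
  choose g hg using hf
  generalize hr : Module.finrank ℚ (Submodule.span ℚ (Set.range row)) = r at f g hg hspan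
  have hrn : r < n := by
    have hle : Submodule.span ℚ (Set.range row) ≤
        LinearMap.ker (∑ j, x j • (LinearMap.proj j : (ι → ℚ) →ₗ[ℚ] ℚ)) := by
      rw [Submodule.span_le]
      rintro _ ⟨i, rfl⟩
      simpa [row, LinearMap.sum_apply, mul_comm] using hCx i
    have hne : Submodule.span ℚ (Set.range row) ≠ ⊤ := by
      intro htop
      rw [htop] at hle
      obtain ⟨j, hj⟩ := Function.ne_iff.mp hx
      have := hle (Submodule.mem_top (x := Pi.single j (1 : ℚ)))
      simp [LinearMap.sum_apply, Pi.single_apply] at this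
      exact hj this
    have := Submodule.finrank_lt hne
    rwa [Module.finrank_pi, hr] at this
  have key : ∀ t : ι → ℤ, (∀ l, ∑ j, C (g l) j * t j = 0) → ∀ i, ∑ j, C i j * t j = 0 := by
    intro t ht i
    have hle : Submodule.span ℚ (Set.range f) ≤
        LinearMap.ker (∑ j, (t j : ℚ) • (LinearMap.proj j : (ι → ℚ) →ₗ[ℚ] ℚ)) := by
      rw [Submodule.span_le]
      rintro _ ⟨l, rfl⟩
      have := ht l
      rw [← hg l]
      simp only [SetLike.mem_coe, LinearMap.mem_ker, LinearMap.sum_apply, LinearMap.smul_apply,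
        LinearMap.proj_apply, smul_eq_mul, row]
      exact_mod_cast (by simpa [mul_comm] using this : ∑ j, t j * C (g l) j = 0)
    rw [hspan] at hle
    have := hle (Submodule.subset_span ⟨i, rfl⟩)
    simp only [LinearMap.mem_ker, LinearMap.sum_apply, LinearMap.smul_apply,
        LinearMap.proj_apply, smul_eq_mul, row] at this
    have h2 : ∑ j, t j * C i j = 0 := by exact_mod_cast this
    simpa [mul_comm] using h2
  have hbase : 1 ≤ n * a := Nat.mul_pos hn1 ha
  -- Siegel's lemma needs at least one equation; with rank zero every vector is in the kernel.
  rcases Nat.eq_zero_or_pos r with h0 | hpos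
  · refine ⟨fun _ => 1, ?_, key _ fun l => (Fin.cast h0 l).elim0, fun j => ?_⟩
    · obtain ⟨j, -⟩ := Function.ne_iff.mp hx
      exact Function.ne_iff.mpr ⟨j, by simp⟩
    · rw [abs_one]
      exact_mod_cast Nat.one_le_pow n (n * a) hbase
  · let D : Matrix (Fin r) ι ℤ := fun l j => C (g l) j
    obtain ⟨t, ht0, htD, htn⟩ := Int.Matrix.exists_ne_zero_int_vec_norm_le D
      (by simpa using hrn) (by simpa using hpos)
    refine ⟨t, ht0, key t fun l => congrFun htD l, fun j => ?_⟩
    let _ : SeminormedAddCommGroup (Matrix (Fin r) ι ℤ) := Matrix.seminormedAddCommGroup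
    have hD : ‖D‖ ≤ a := by
      refine (Matrix.norm_le_iff (by positivity)).mpr fun l j => ?_
      rw [Int.norm_eq_abs]
      exact_mod_cast hC (g l) j
    have h1 : ((|t j| : ℤ) : ℝ) ≤ ‖t‖ := by
      have := norm_le_pi_norm t j
      rwa [Int.norm_eq_abs, ← Int.cast_abs] at this
    have ha' : (1 : ℝ) ≤ a := by exact_mod_cast ha
    have hn' : (1 : ℝ) ≤ n := by exact_mod_cast hn1
    have hrn' : (r : ℝ) + 1 ≤ n := by exact_mod_cast hrn
    have hmax : max 1 ‖D‖ ≤ a := max_le ha' hD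
    -- Siegel's exponent `r / (n - r)` is at most `n`, since `n - r ≥ 1`.
    have h2 : ‖t‖ ≤ ((n : ℝ) * a) ^ (n : ℝ) := by
      refine htn.trans ?_
      rw [Fintype.card_fin, ← hn]
      refine (Real.rpow_le_rpow (by positivity)
        (mul_le_mul_of_nonneg_left hmax (by positivity)) ?_).trans
        (Real.rpow_le_rpow_of_exponent_le ?_ ?_)
      · exact div_nonneg (by positivity) (by linarith)
      · nlinarith
      · rw [div_le_iff₀ (by linarith)]
        nlinarith
    rw [Real.rpow_natCast] at h2
    exact_mod_cast h1.trans h2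

theorem Fintype.sum_subtype_of_eq_zero {ι M : Type*} [Fintype ι] [AddCommMonoid M] (p : ι → Prop)
    [DecidablePred p] (f : ι → M) (h : ∀ i, ¬ p i → f i = 0) :
    ∑ i : {i // p i}, f i = ∑ i, f i := by
  rw [← Finset.sum_subtype (Finset.univ.filter p) (by simp) f, Finset.sum_filter_of_ne]
  intro i _ hi
  by_contra hp
  exact hi (h i hp)

/-- Discarding the columns where `x` vanishes keeps `x` a kernel vector, so the previous bound
applies to the remaining columns and the result extends by zero. -/
theorem exists_small_int_kernel_supported {κ ι : Type*} [Fintype ι] (C : κ → ι → ℤ) (a : ℕ)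
    (ha : 1 ≤ a) (hC : ∀ i j, |C i j| ≤ a) (x : ι → ℚ) (hx : x ≠ 0)
    (hCx : ∀ i, ∑ j, (C i j : ℚ) * x j = 0) :
    ∃ t : ι → ℤ, t ≠ 0 ∧ (∀ i, ∑ j, C i j * t j = 0) ∧ (∀ j, x j = 0 → t j = 0) ∧
      ∀ j, |t j| ≤ ((Fintype.card ι * a) ^ Fintype.card ι : ℕ) := by
  classical
  obtain ⟨j₀, hj₀⟩ := Function.ne_iff.mp hx
  obtain ⟨t, ht0, htC, htb⟩ := exists_small_int_kernel (ι := {j // x j ≠ 0})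
    (fun i j => C i j) a ha (fun i j => hC i j) (fun j => x j)
    (Function.ne_iff.mpr ⟨⟨j₀, hj₀⟩, hj₀⟩) (fun i =>
      (Fintype.sum_subtype_of_eq_zero (x · ≠ 0) (fun j => (C i j : ℚ) * x j)
        (by simp +contextual)).trans (hCx i))
  obtain ⟨⟨j₁, hj₁⟩, htj₁⟩ := Function.ne_iff.mp ht0
  refine ⟨fun j => if h : x j ≠ 0 then t ⟨j, h⟩ else 0,
    Function.ne_iff.mpr ⟨j₁, by simpa [hj₁] using htj₁⟩, fun i => ?_, by simp +contextual,
    fun j => ?_⟩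
  · rw [← Fintype.sum_subtype_of_eq_zero (x · ≠ 0) _ (by simp +contextual)]
    refine (Finset.sum_congr rfl fun j _ => ?_).trans (htC i)
    simp [j.2]
  · have hcard : Fintype.card {j // x j ≠ 0} ≤ Fintype.card ι := Fintype.card_subtype_le _
    have h1 : 1 ≤ Fintype.card ι * a := Nat.mul_pos (Fintype.card_pos_iff.mpr ⟨j⟩) ha
    have hle : (Fintype.card {j // x j ≠ 0} * a) ^ Fintype.card {j // x j ≠ 0} ≤
        (Fintype.card ι * a) ^ Fintype.card ι :=
      (Nat.pow_le_pow_left (Nat.mul_le_mul_right a hcard) _).trans (Nat.pow_le_pow_right h1 hcard)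
    dsimp only
    split_ifs with h
    · exact (htb ⟨j, h⟩).trans (by exact_mod_cast hle)
    · simp only [abs_zero]
      positivity

/-- A nonnegative kernel vector that is positive at `i` can be replaced by a small one. -/
theorem exists_small_nonneg_kernel {κ ι : Type*} [Fintype ι] (C : κ → ι → ℤ) (a : ℕ)
    (ha : 1 ≤ a) (hC : ∀ i j, |C i j| ≤ a) (i : ι) (x : ι → ℤ) (hx : 0 ≤ x) (hxi : 0 < x i)
    (hCx : ∀ l, ∑ j, C l j * x j = 0) :
    ∃ h : ι → ℤ, 0 ≤ h ∧ 0 < h i ∧ (∀ l, ∑ j, C l j * h j = 0) ∧ (∀ j, x j = 0 → h j = 0) ∧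
      ∀ j, h j ≤ ((Fintype.card ι * a) ^ Fintype.card ι : ℕ) := by
  classical
  induction hn : (Finset.univ.filter (x · ≠ 0)).card using Nat.strong_induction_on
    generalizing x with
  | _ n ih =>
  obtain ⟨t, ht0, htC, hts, htb⟩ := exists_small_int_kernel_supported C a ha hC
    (fun j => (x j : ℚ)) (Function.ne_iff.mpr ⟨i, by simpa using hxi.ne'⟩)
    (fun l => by exact_mod_cast hCx l)
  have hts' : ∀ j, x j = 0 → t j = 0 := fun j hj => hts j (by simpa using hj)
  -- Descent on the support: moving from `x` along `-g` until the first coordinate with `0 < g j`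
  -- reaches zero (minimal ratio `x j / g j`) keeps the vector nonnegative and shrinks its support.
  -- Coordinate `i` stays positive because `g i = 0`; multiplying by `g j` keeps everything
  -- integral.
  have reduce : ∀ g : ι → ℤ, (∀ l, ∑ j, C l j * g j = 0) → g i = 0 → (∀ j, x j = 0 → g j = 0) →
      (∃ j, 0 < g j) → ∃ h : ι → ℤ, 0 ≤ h ∧ 0 < h i ∧ (∀ l, ∑ j, C l j * h j = 0) ∧
        (∀ j, x j = 0 → h j = 0) ∧ ∀ j, h j ≤ ((Fintype.card ι * a) ^ Fintype.card ι : ℕ) := by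
    rintro g hgC hgi hgs ⟨j₀, hj₀⟩
    obtain ⟨j, hj, hmin⟩ := Finset.exists_min_image (Finset.univ.filter (0 < g ·))
      (fun j => (x j : ℚ) / g j) ⟨j₀, by simpa using hj₀⟩
    simp only [Finset.mem_filter, Finset.mem_univ, true_and] at hj hmin
    have hjx : x j ≠ 0 := fun h => hj.ne' (hgs j h)
    have hsub : ∀ l, x l = 0 → g j * x l - x j * g l = 0 := fun l hl => by simp [hl, hgs l hl]
    refine (ih _ ?_ (fun l => g j * x l - x j * g l) ?_ ?_ ?_ rfl).imp
      fun h ⟨h0, hi, hk, hs, hb⟩ => ⟨h0, hi, hk, fun l hl => hs l (hsub l hl), hb⟩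
    · rw [← hn]
      refine Finset.card_lt_card (Finset.ssubset_iff_subset_ne.mpr ⟨fun l => ?_, fun he => ?_⟩)
      · simp only [Finset.mem_filter, Finset.mem_univ, true_and]
        exact mt (hsub l)
      · have : j ∈ Finset.univ.filter (x · ≠ 0) := by simpa using hjx
        rw [← he] at this
        simp [mul_comm] at this
    · intro l
      change 0 ≤ g j * x l - x j * g l
      rcases lt_or_ge 0 (g l) with hl | hl
      · have := hmin l hl
        rw [div_le_div_iff₀ (by exact_mod_cast hj) (by exact_mod_cast hl)] at this
        have : x j * g l ≤ x l * g j := by exact_mod_cast this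
        linarith
      · have := mul_nonneg hj.le (hx l)
        have := mul_nonneg_of_nonpos_of_nonpos (neg_nonpos.mpr (hx j)) hl
        dsimp only at *
        nlinarith
    · simp only [hgi, mul_zero, sub_zero]
      exact mul_pos hj hxi
    · intro l
      have : ∑ m, C l m * (g j * x m - x j * g m) =
          g j * ∑ m, C l m * x m - x j * ∑ m, C l m * g m := by
        rw [Finset.mul_sum, Finset.mul_sum, ← Finset.sum_sub_distrib]
        exact Finset.sum_congr rfl fun m _ => by ring
      rw [this, hCx, hgC]
      simp
  -- This combination of `t` and `x` vanishes at `i`. If it is nonzero, it or its negative feeds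
  -- `reduce`; if it is zero, `t` is proportional to `x`, so `t` up to sign is the required vector.
  set g : ι → ℤ := fun j => x i * t j - t i * x j with hg
  have hgC : ∀ l, ∑ j, C l j * g j = 0 := fun l => by
    have : ∑ m, C l m * g m = x i * ∑ m, C l m * t m - t i * ∑ m, C l m * x m := by
      rw [Finset.mul_sum, Finset.mul_sum, ← Finset.sum_sub_distrib]
      exact Finset.sum_congr rfl fun m _ => by simp only [hg]; ring
    rw [this, hCx, htC]
    simp
  have hgi : g i = 0 := by simp [hg, mul_comm]
  have hgs : ∀ j, x j = 0 → g j = 0 := fun j hj => by simp [hg, hj, hts' j hj]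
  by_cases hpos : ∃ j, 0 < g j
  · exact reduce g hgC hgi hgs hpos
  by_cases hneg : ∃ j, g j < 0
  · refine reduce (fun j => - g j) (fun l => ?_) (by simpa using hgi) (by simpa using hgs)
      (by simpa using hneg)
    simpa using hgC l
  push Not at hpos hneg
  have hgz : ∀ j, x i * t j = t i * x j := fun j => by
    have := (hpos j).antisymm (hneg j)
    simp only [hg] at this
    linarith
  have hti : t i ≠ 0 := fun h => ht0 (funext fun j => by
    have := hgz j
    rw [h, zero_mul] at this
    exact (mul_eq_zero.mp this).resolve_left hxi.ne')
  have hsign : ∀ j, 0 ≤ (t i).sign * t j := fun j => by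
    have h1 : x i * ((t i).sign * t j) = |t i| * x j := by
      rw [← Int.sign_mul_self_eq_abs, mul_left_comm, hgz, mul_assoc]
    have h2 : 0 ≤ |t i| * x j := mul_nonneg (abs_nonneg _) (hx j)
    rw [← h1] at h2
    exact nonneg_of_mul_nonneg_right h2 hxi
  refine ⟨fun j => (t i).sign * t j, hsign, ?_, fun l => ?_, fun j hj => by simp [hts' j hj],
    fun j => ?_⟩
  · change 0 < (t i).sign * t i
    rw [Int.sign_mul_self_eq_abs]
    exact abs_pos.mpr hti
  · have : ∑ j, C l j * ((t i).sign * t j) = (t i).sign * ∑ j, C l j * t j := by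
      rw [Finset.mul_sum]
      exact Finset.sum_congr rfl fun m _ => by ring
    rw [this, htC, mul_zero]
  · refine (le_abs_self _).trans (le_trans ?_ (htb j))
    rw [abs_mul, Int.abs_sign_of_ne_zero hti, one_mul]

/-- Every rational kernel vector is close to an integer kernel vector with no larger support. -/
theorem exists_int_kernel_near {κ ι : Type*} [Fintype ι] (C : κ → ι → ℤ) (a : ℕ)
    (ha : 1 ≤ a) (hC : ∀ i j, |C i j| ≤ a) (g : ι → ℚ)
    (hCg : ∀ l, ∑ j, (C l j : ℚ) * g j = 0) :
    ∃ h : ι → ℤ, (∀ l, ∑ j, C l j * h j = 0) ∧ (∀ j, g j = 0 → h j = 0) ∧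
      ∀ j, |g j - h j| ≤ (Fintype.card ι * (Fintype.card ι * a) ^ Fintype.card ι : ℕ) := by
  classical
  set β := (Fintype.card ι * a) ^ Fintype.card ι with hβ
  suffices H : ∃ h : ι → ℤ, (∀ l, ∑ j, C l j * h j = 0) ∧ (∀ j, g j = 0 → h j = 0) ∧
      ∀ j, |g j - h j| ≤ ((Finset.univ.filter (g · ≠ 0)).card * β : ℕ) by
    obtain ⟨h, h1, h2, h3⟩ := H
    refine ⟨h, h1, h2, fun j => (h3 j).trans ?_⟩
    exact_mod_cast Nat.mul_le_mul_right β (Finset.card_le_univ _)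
  induction hn : (Finset.univ.filter (g · ≠ 0)).card using Nat.strong_induction_on
    generalizing g with
  | _ n ih =>
  by_cases hg0 : g = 0
  · exact ⟨0, by simp, by simp, fun j => by simp [hg0]; positivity⟩
  obtain ⟨t, ht0, htC, hts, htb⟩ := exists_small_int_kernel_supported C a ha hC g hg0 hCg
  obtain ⟨j, hj⟩ := Function.ne_iff.mp ht0
  replace hj : t j ≠ 0 := hj
  have hgj : g j ≠ 0 := fun h => hj (hts j h)
  have htq : (t j : ℚ) ≠ 0 := by exact_mod_cast hj
  -- Subtracting `r • t` kills coordinate `j`. The integer part of `r` goes into the answer, while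
  -- its fractional part costs an error of at most `β` per support element removed.
  set r : ℚ := g j / t j with hr
  have hsub : ∀ l, g l = 0 → g l - r * t l = 0 := fun l hl => by simp [hl, hts l hl]
  have hcard : (Finset.univ.filter (fun l => g l - r * t l ≠ 0)).card < n := by
    rw [← hn]
    refine Finset.card_lt_card (Finset.ssubset_iff_subset_ne.mpr ⟨fun l => ?_, fun he => ?_⟩)
    · simp only [Finset.mem_filter, Finset.mem_univ, true_and]
      exact mt (hsub l)
    · have : j ∈ Finset.univ.filter (g · ≠ 0) := by simpa using hgj
      rw [← he] at this
      simp [hr, div_mul_cancel₀ _ htq] at this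
  obtain ⟨h, hk, hs, hb⟩ := ih _ hcard (fun l => g l - r * t l) (fun l => by
    have : ∑ m, (C l m : ℚ) * (g m - r * t m) =
        ∑ m, (C l m : ℚ) * g m - r * ((∑ m, C l m * t m : ℤ) : ℚ) := by
      push_cast
      rw [Finset.mul_sum, ← Finset.sum_sub_distrib]
      exact Finset.sum_congr rfl fun m _ => by ring
    rw [this, hCg, htC]
    simp) rfl
  refine ⟨fun l => h l + ⌊r⌋ * t l, fun l => ?_, fun l hl => ?_, fun l => ?_⟩
  · have : ∑ m, C l m * (h m + ⌊r⌋ * t m) = ∑ m, C l m * h m + ⌊r⌋ * ∑ m, C l m * t m := by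
      rw [Finset.mul_sum, ← Finset.sum_add_distrib]
      exact Finset.sum_congr rfl fun m _ => by ring
    rw [this, hk, htC]
    simp
  · simp [hs l (hsub l hl), hts l hl]
  · have h1 := hb l
    have h2 : |Int.fract r * t l| ≤ β := by
      rw [abs_mul, abs_of_nonneg (Int.fract_nonneg r)]
      have h3 : |(t l : ℚ)| ≤ β := by exact_mod_cast htb l
      calc Int.fract r * |(t l : ℚ)| ≤ 1 * |(t l : ℚ)| :=
            mul_le_mul_of_nonneg_right (Int.fract_lt_one r).le (abs_nonneg _)
        _ ≤ β := by rwa [one_mul]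
    have h4 : g l - ((h l + ⌊r⌋ * t l : ℤ) : ℚ) = (g l - r * t l - h l) + Int.fract r * t l := by
      rw [Int.fract]
      push_cast
      ring
    rw [h4]
    refine (abs_add_le _ _).trans ((add_le_add h1 h2).trans ?_)
    have h5 : (Finset.univ.filter (fun l => g l - r * t l ≠ 0)).card * β + β ≤ n * β := by
      rw [← Nat.succ_mul]
      exact Nat.mul_le_mul_right β hcard
    exact_mod_cast h5

/-! ### Firing sequences and reachability -/

namespace PetriNet

variable {P T : Type*} {N : PetriNet P T}

theorem Fires.add_right {t : T} {M M' : P → ℕ} (h : N.Fires t M M') (R : P → ℕ) :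
    N.Fires t (M + R) (M' + R) := fun p => by
  obtain ⟨h1, h2⟩ := h p
  refine ⟨h1.trans (Nat.le_add_right _ _), ?_⟩
  simp only [Pi.add_apply]
  push_cast
  rw [h2]
  ring

theorem FiresSeq.add_right {σ : List T} {M M' : P → ℕ} (h : N.FiresSeq σ M M') (R : P → ℕ) :
    N.FiresSeq σ (M + R) (M' + R) := by
  induction σ generalizing M with
  | nil =>
    change M = M' at h
    rw [h]
    rfl
  | cons t σ ih =>
    obtain ⟨L, hL, h⟩ := h
    exact ⟨L + R, hL.add_right R, ih h⟩

theorem firesSeq_append {σ τ : List T} {M M' : P → ℕ} :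
    N.FiresSeq (σ ++ τ) M M' ↔ ∃ L, N.FiresSeq σ M L ∧ N.FiresSeq τ L M' := by
  induction σ generalizing M with
  | nil => exact ⟨fun h => ⟨M, rfl, h⟩, fun ⟨L, hL, h⟩ => by cases hL; exact h⟩
  | cons t σ ih =>
    constructor
    · rintro ⟨L, hL, h⟩
      obtain ⟨L', h1, h2⟩ := ih.mp h
      exact ⟨L', ⟨L, hL, h1⟩, h2⟩
    · rintro ⟨L', ⟨L, hL, h1⟩, h2⟩
      exact ⟨L, hL, ih.mpr ⟨L', h1, h2⟩⟩

theorem firesSeq_singleton {t : T} {M M' : P → ℕ} : N.FiresSeq [t] M M' ↔ N.Fires t M M' :=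
  ⟨fun ⟨_, h, he⟩ => by cases he; exact h, fun h => ⟨M', h, rfl⟩⟩

theorem FiresSeq.marking_eq [Fintype T] [DecidableEq T] {σ : List T} {M M' : P → ℕ}
    (h : N.FiresSeq σ M M') (p : P) :
    (M' p : ℤ) = M p + ∑ t, N.incidence p t * (σ.count t : ℤ) := by
  induction σ generalizing M with
  | nil =>
    change M = M' at h
    simp [h]
  | cons t σ ih =>
    obtain ⟨L, hL, h⟩ := h
    rw [ih h, (hL p).2, add_assoc]
    congr 1
    have : ∀ s, N.incidence p s * (((t :: σ).count s : ℕ) : ℤ) =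
        (if s = t then N.incidence p s else 0) + N.incidence p s * (σ.count s : ℤ) := fun s => by
      rw [List.count_cons]
      by_cases hs : s = t
      · simp [hs]
        ring
      · simp [hs, Ne.symm hs]
    simp only [this]
    rw [Finset.sum_add_distrib]
    simp

theorem Reaches.refl (M : P → ℕ) : N.Reaches M M := ⟨[], rfl⟩

theorem Reaches.trans {M L M' : P → ℕ} (h : N.Reaches M L) (h' : N.Reaches L M') :
    N.Reaches M M' := by
  obtain ⟨σ, hσ⟩ := h
  obtain ⟨τ, hτ⟩ := h'
  exact ⟨σ ++ τ, firesSeq_append.mpr ⟨L, hσ, hτ⟩⟩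

theorem Fires.reaches {t : T} {M M' : P → ℕ} (h : N.Fires t M M') : N.Reaches M M' :=
  ⟨[t], firesSeq_singleton.mpr h⟩

theorem Reaches.add_right {M M' : P → ℕ} (h : N.Reaches M M') (R : P → ℕ) :
    N.Reaches (M + R) (M' + R) := by
  obtain ⟨σ, hσ⟩ := h
  exact ⟨σ, hσ.add_right R⟩

theorem Reaches.add {M M' L L' : P → ℕ} (h : N.Reaches M M') (h' : N.Reaches L L') :
    N.Reaches (M + L) (M' + L') := by
  refine (h.add_right L).trans ?_
  rw [add_comm M' L, add_comm M' L']
  exact h'.add_right M'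

theorem Reaches.nsmul {M M' : P → ℕ} (h : N.Reaches M M') (n : ℕ) :
    N.Reaches (n • M) (n • M') := by
  induction n with
  | zero => simpa using Reaches.refl _
  | succ n ih =>
    rw [succ_nsmul, succ_nsmul]
    exact ih.add h

/-- A marking that covers the total consumption of the transitions in `z` can fire all of them. -/
theorem reaches_of_sum_pre_le [Fintype T] (z : T → ℕ) (M M' : P → ℕ)
    (hM : ∀ p, ∑ t, z t * N.Pre p t ≤ M p)
    (hM' : ∀ p, (M' p : ℤ) = M p + ∑ t, N.incidence p t * (z t : ℤ)) : N.Reaches M M' := by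
  classical
  induction hn : ∑ t, z t generalizing z M with
  | zero =>
    have hz : ∀ t, z t = 0 := fun t => by
      simpa using (Finset.sum_eq_zero_iff.mp hn) t (Finset.mem_univ t)
    have : M = M' := funext fun p => by
      have := hM' p
      simp only [hz, Nat.cast_zero, mul_zero, Finset.sum_const_zero, add_zero] at this
      exact_mod_cast this.symm
    rw [this]
    exact Reaches.refl _
  | succ n ih =>
    obtain ⟨t, -, ht⟩ := Finset.exists_ne_zero_of_sum_ne_zero (hn.trans_ne n.succ_ne_zero)
    obtain ⟨y, hy⟩ : ∃ y : T → ℕ, y = z - Pi.single t 1 := ⟨_, rfl⟩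
    have hsplit : ∀ s, z s = y s + (Pi.single t 1 : T → ℕ) s := fun s => by
      rw [hy]
      by_cases hs : s = t
      · subst hs
        simp only [Pi.sub_apply, Pi.single_eq_same]
        omega
      · simp [hs]
    have hsum : ∀ p, ∑ s, z s * N.Pre p s = ∑ s, y s * N.Pre p s + N.Pre p t := by
      intro p
      simp only [hsplit, add_mul]
      rw [Finset.sum_add_distrib]
      simp [Pi.single_apply]
    have hinc : ∀ p, ∑ s, N.incidence p s * (z s : ℤ) =
        ∑ s, N.incidence p s * (y s : ℕ) + N.incidence p t := by
      intro p
      simp only [hsplit, Nat.cast_add, mul_add]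
      rw [Finset.sum_add_distrib]
      congr 1
      simp [Pi.single_apply]
    have hge : ∀ p, N.Pre p t ≤ M p := fun p => by have := hM p; rw [hsum] at this; omega
    have hfire : N.Fires t M (fun p => M p - N.Pre p t + N.Post p t) := fun p => by
      refine ⟨hge p, ?_⟩
      have := hge p
      simp only [incidence]
      push_cast [Nat.cast_sub this]
      ring
    refine hfire.reaches.trans (ih y (fun p => M p - N.Pre p t + N.Post p t) (fun p => ?_) (fun p => ?_) ?_)
    · have := hM p
      rw [hsum] at this
      omega
    · rw [hM' p, hinc, ((hfire p).2)]
      ring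
    · simp only [hsplit] at hn
      rw [Finset.sum_add_distrib] at hn
      simpa using hn

/-- The net with all transitions reversed. -/
def reverse (N : PetriNet P T) : PetriNet P T := ⟨N.Post, N.Pre⟩

theorem incidence_reverse (p : P) (t : T) : N.reverse.incidence p t = - N.incidence p t := by
  simp [incidence, reverse]

theorem Fires.reverse {t : T} {M M' : P → ℕ} (h : N.Fires t M M') : N.reverse.Fires t M' M :=
  fun p => by
    obtain ⟨h1, h2⟩ := h p
    rw [incidence_reverse, h2]
    refine ⟨?_, by ring⟩
    simp only [incidence] at h2
    change N.Post p t ≤ M' p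
    omega

theorem FiresSeq.reverse {σ : List T} {M M' : P → ℕ} (h : N.FiresSeq σ M M') :
    N.reverse.FiresSeq σ.reverse M' M := by
  induction σ generalizing M with
  | nil => exact Eq.symm h
  | cons t σ ih =>
    obtain ⟨L, hL, h⟩ := h
    rw [List.reverse_cons]
    exact firesSeq_append.mpr ⟨L, ih h, firesSeq_singleton.mpr hL.reverse⟩

theorem Reaches.of_reverse {M M' : P → ℕ} (h : N.reverse.Reaches M M') : N.Reaches M' M := by
  obtain ⟨σ, hσ⟩ := h
  exact ⟨_, hσ.reverse⟩

/-- If `σ` can be fired from a multiple of `M`, then from a suitable small multiple of `M` one can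
mark all places that are marked by `M` or adjacent to a transition of `σ`. -/
theorem FiresSeq.exists_marked [Fintype T] [DecidableEq T] {σ : List T} {M X : P → ℕ} {n : ℕ}
    (h : N.FiresSeq σ (n • M) X) (K : ℕ) (hK : ∀ p t, N.Pre p t < K) (hK0 : 0 < K) :
    ∃ (u : T → ℕ) (L : P → ℕ), N.Reaches (K ^ σ.toFinset.card • M) L ∧
      (∀ p, (L p : ℤ) = (K ^ σ.toFinset.card * M p : ℕ) + ∑ t, N.incidence p t * (u t : ℤ)) ∧
      (∀ t, t ∉ σ → u t = 0) ∧ (∀ t, u t ≤ (K + 1) ^ σ.toFinset.card) ∧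
      (∀ p, 0 < M p → 0 < L p) ∧ (∀ p, 0 < X p → 0 < L p) ∧
      (∀ t ∈ σ, ∀ p, 0 < N.Pre p t ∨ 0 < N.Post p t → 0 < L p) := by
  induction σ using List.reverseRecOn generalizing X with
  | nil =>
    change n • M = X at h
    subst h
    refine ⟨0, M, by simpa using Reaches.refl M, by simp, by simp, by simp, by simp, ?_, by simp⟩
    intro p hp
    simp only [Pi.smul_apply, smul_eq_mul] at hp
    exact Nat.pos_of_mul_pos_left hp
  | append_singleton σ t ih =>
    obtain ⟨Y, hY, ht⟩ := firesSeq_append.mp h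
    rw [firesSeq_singleton] at ht
    obtain ⟨u, L, hL, hLu, hu0, huK, hM, hYL, hσ⟩ := ih hY
    -- A repeated transition marks nothing new, so only first occurrences cost a factor `K`.
    by_cases hmem : t ∈ σ
    · have hfin : (σ ++ [t]).toFinset = σ.toFinset := by
        ext s
        simp only [List.mem_toFinset, List.mem_append, List.mem_singleton]
        grind
      rw [hfin]
      refine ⟨u, L, hL, hLu, fun s hs => hu0 s (by grind), huK, hM, fun p hp => ?_,
        fun s hs => hσ s (by grind)⟩
      by_cases hp' : 0 < Y p
      · exact hYL p hp'
      · refine hσ t hmem p (Or.inr ?_)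
        have := (ht p).2
        simp only [incidence] at this
        omega
    · have hcard : (σ ++ [t]).toFinset.card = σ.toFinset.card + 1 := by
        have : (σ ++ [t]).toFinset = insert t σ.toFinset := by
          ext s
          simp only [List.mem_toFinset, List.mem_append, List.mem_singleton, Finset.mem_insert]
          tauto
        rw [this, Finset.card_insert_of_notMem (by simpa using hmem)]
      -- In `K` copies of `L` each marked place holds strictly more than `t` consumes, so firing `t`
      -- once unmarks nothing.
      have hpre : ∀ p, 0 < L p → N.Pre p t < K * L p := fun p hp =>
        (hK p t).trans_le (Nat.le_mul_of_pos_right K hp)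
      have hpre' : ∀ p, N.Pre p t ≤ K * L p := fun p => by
        rcases Nat.eq_zero_or_pos (N.Pre p t) with h0 | h0
        · rw [h0]
          exact Nat.zero_le _
        · exact (hpre p (hYL p (h0.trans_le (ht p).1))).le
      have hfire : N.Fires t (K • L) (fun p => K * L p - N.Pre p t + N.Post p t) := fun p => by
        refine ⟨hpre' p, ?_⟩
        have := hpre' p
        simp only [incidence, Pi.smul_apply, smul_eq_mul]
        push_cast [Nat.cast_sub this]
        ring
      have hLpos : ∀ p, 0 < L p → 0 < K * L p - N.Pre p t + N.Post p t := fun p hp => by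
        have := hpre p hp
        omega
      rw [hcard]
      refine ⟨fun s => K * u s + if s = t then 1 else 0,
        fun p => K * L p - N.Pre p t + N.Post p t, ?_, fun p => ?_, fun s hs => ?_,
        fun s => ?_, fun p hp => hLpos p (hM p hp), fun p hp => ?_, fun s hs p hp => ?_⟩
      · rw [pow_succ', mul_smul]
        exact (hL.nsmul K).trans hfire.reaches
      · rw [(hfire p).2]
        have : ∀ s, N.incidence p s * ((K * u s + if s = t then 1 else 0 : ℕ) : ℤ) =
            K * (N.incidence p s * u s) + if s = t then N.incidence p s else 0 := fun s => by
          split_ifs <;> push_cast <;> ring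
        simp only [this]
        rw [Finset.sum_add_distrib, ← Finset.mul_sum, pow_succ']
        simp only [Pi.smul_apply, smul_eq_mul, Finset.sum_ite_eq', Finset.mem_univ, if_true]
        push_cast
        rw [hLu p]
        push_cast
        ring
      · have : s ≠ t := by grind
        simp [this, hu0 s (by grind)]
      · have h1 : K * u s ≤ K * (K + 1) ^ σ.toFinset.card := Nat.mul_le_mul_left K (huK s)
        have h2 : 1 ≤ (K + 1) ^ σ.toFinset.card := Nat.one_le_pow _ _ (by omega)
        rw [pow_succ', add_mul, one_mul]
        dsimp only
        split_ifs <;> omega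
      · have := (ht p).2
        simp only [incidence] at this
        by_cases hp' : 0 < Y p
        · exact hLpos p (hYL p hp')
        · have : 0 < N.Post p t := by omega
          dsimp only
          omega
      · rcases List.mem_append.mp hs with hs | hs
        · exact hLpos p (hσ s hs p hp)
        · rw [List.mem_singleton] at hs
          subst hs
          rcases hp with hp | hp
          · exact hLpos p (hYL p (hp.trans_le (ht p).1))
          · dsimp only
            omega

end PetriNet

/-! ### Small solutions of the marking equation -/

/-- Homogenise: with `-b` as an additional column, `(m, x)` is a nonnegative kernel vector. Adding
up, over its support, small nonnegative kernel vectors positive at the respective coordinate gives a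
small vector with exactly the same support; the extra coordinate is `d`. -/
theorem exists_small_scaled_solution {P T : Type*} [Fintype T] (A : P → T → ℤ) (b : P → ℤ) (a : ℕ)
    (ha : 1 ≤ a) (hA : ∀ p t, |A p t| ≤ a) (hb : ∀ p, |b p| ≤ a) (x : T → ℕ) (m : ℕ) (hm : 0 < m)
    (hx : ∀ p, ∑ t, A p t * (x t : ℤ) = m * b p) :
    ∃ (v : T → ℕ) (d : ℕ), 0 < d ∧ (∀ p, ∑ t, A p t * (v t : ℤ) = d * b p) ∧
      (∀ t, v t = 0 ↔ x t = 0) ∧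
      d ≤ (Fintype.card T + 1) * ((Fintype.card T + 1) * a) ^ (Fintype.card T + 1) ∧
      ∀ t, v t ≤ (Fintype.card T + 1) * ((Fintype.card T + 1) * a) ^ (Fintype.card T + 1) := by
  classical
  let C : P → Option T → ℤ := fun p i => i.elim (- b p) (A p)
  let y : Option T → ℤ := fun i => i.elim (m : ℤ) (fun t => (x t : ℤ))
  have hC : ∀ p i, |C p i| ≤ a := by
    rintro p (_ | t)
    · simpa [C] using hb p
    · exact hA p t
  have hy : 0 ≤ y := by
    rintro (_ | t) <;> simp [y]
  have hCy : ∀ p, ∑ i, C p i * y i = 0 := fun p => by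
    rw [Fintype.sum_option]
    simp only [C, y, Option.elim]
    rw [hx]
    ring
  have H : ∀ i : Option T, ∃ h : Option T → ℤ, 0 ≤ h ∧ (0 < y i → 0 < h i) ∧
      (∀ l, ∑ j, C l j * h j = 0) ∧ (∀ j, y j = 0 → h j = 0) ∧
      ∀ j, h j ≤ ((Fintype.card (Option T) * a) ^ Fintype.card (Option T) : ℕ) := fun i => by
    by_cases hi : 0 < y i
    · obtain ⟨h, h0, h1, h2⟩ := exists_small_nonneg_kernel C a ha hC i y hy hi hCy
      exact ⟨h, h0, fun _ => h1, h2⟩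
    · exact ⟨0, le_rfl, fun h => absurd h hi, by simp, by simp, fun j => by
        simp only [Pi.zero_apply]; positivity⟩
  choose h h0 hpos hk hs hbd using H
  set w : Option T → ℤ := fun j => ∑ i, h i j with hw
  have hw0 : ∀ j, 0 ≤ w j := fun j => Finset.sum_nonneg fun i _ => h0 i j
  have hwpos : ∀ j, 0 < y j → 0 < w j := fun j hj =>
    (hpos j hj).trans_le (Finset.single_le_sum (f := fun i => h i j) (fun i _ => h0 i j)
      (Finset.mem_univ j))
  have hwk : ∀ p, ∑ j, C p j * w j = 0 := fun p => by
    simp only [hw, Finset.mul_sum]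
    rw [Finset.sum_comm]
    exact Finset.sum_eq_zero fun i _ => hk i p
  have hwb : ∀ j, w j ≤
      ((Fintype.card T + 1) * ((Fintype.card T + 1) * a) ^ (Fintype.card T + 1) : ℕ) := fun j => by
    refine (Finset.sum_le_card_nsmul _ _ _ fun i _ => hbd i j).trans ?_
    simp
  have hwz : ∀ j, y j = 0 → w j = 0 := fun j hj => Finset.sum_eq_zero fun i _ => hs i j hj
  refine ⟨fun t => (w (some t)).toNat, (w none).toNat, ?_, fun p => ?_, fun t => ?_, ?_,
    fun t => ?_⟩
  · have := hwpos none (by simpa [y] using hm)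
    omega
  · have := hwk p
    rw [Fintype.sum_option] at this
    simp only [C, Option.elim] at this
    simp only [Int.toNat_of_nonneg (hw0 _)]
    linarith
  · constructor
    · intro ht
      dsimp only at ht
      by_contra hxt
      have := hwpos (some t) (by simp only [y, Option.elim]; omega)
      omega
    · intro ht
      have := hwz (some t) (by simp [y, ht])
      dsimp only
      omega
  · have := hwb none
    omega
  · have := hwb (some t)
    dsimp only
    omega

/-- The difference `y₀ - v / d` is a rational kernel vector. Subtracting a nearby integer kernel
vector from `y₀` leaves an integer solution close to the small vector `v / d`. -/
theorem exists_small_int_solution {P T : Type*} [Fintype T] (A : P → T → ℤ) (b : P → ℤ) (a : ℕ)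
    (ha : 1 ≤ a) (hA : ∀ p t, |A p t| ≤ a) (v : T → ℕ) (d : ℕ) (hd : 0 < d)
    (hv : ∀ p, ∑ t, A p t * (v t : ℤ) = d * b p) (y₀ : T → ℤ)
    (hy₀ : ∀ p, ∑ t, A p t * y₀ t = b p) :
    ∃ y : T → ℤ, (∀ p, ∑ t, A p t * y t = b p) ∧ (∀ t, v t = 0 → y₀ t = 0 → y t = 0) ∧
      ∀ t, |y t| ≤ (v t + Fintype.card T * (Fintype.card T * a) ^ Fintype.card T : ℕ) := by
  have hdq : (d : ℚ) ≠ 0 := by positivity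
  obtain ⟨h, hk, hs, hb⟩ := exists_int_kernel_near A a ha hA (fun t => y₀ t - v t / d)
    (fun p => by
      have h1 : (∑ t, A p t * v t : ℚ) = d * b p := by exact_mod_cast hv p
      have h2 : (∑ t, A p t * y₀ t : ℚ) = b p := by exact_mod_cast hy₀ p
      simp only [mul_sub, Finset.sum_sub_distrib]
      rw [h2]
      simp only [mul_div_assoc']
      rw [← Finset.sum_div, h1, mul_div_cancel_left₀ _ hdq, sub_self])
  refine ⟨fun t => y₀ t - h t, fun p => ?_, fun t hvt hyt => ?_, fun t => ?_⟩
  · simp only [mul_sub, Finset.sum_sub_distrib]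
    rw [hy₀, hk, sub_zero]
  · simp [hyt, hs t (by simp [hyt, hvt])]
  · have h1 := hb t
    have h2 : ((y₀ t - h t : ℤ) : ℚ) = (y₀ t - v t / d - h t) + v t / d := by
      push_cast
      ring
    have h3 : |(v t / d : ℚ)| ≤ v t := by
      rw [abs_of_nonneg (by positivity)]
      exact div_le_self (by positivity) (by exact_mod_cast hd)
    have h4 : |((y₀ t - h t : ℤ) : ℚ)| ≤
        (v t + Fintype.card T * (Fintype.card T * a) ^ Fintype.card T : ℕ) := by
      rw [h2]
      refine (abs_add_le _ _).trans ?_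
      push_cast at h1 ⊢
      linarith
    exact_mod_cast h4

/-! ### Assembling a cut-off from small solutions -/

namespace PetriNet

variable {P T : Type*} [Fintype T] {N : PetriNet P T}

/-- Copies of `X` are converted into copies of `X'` one at a time. Every place that `z` consumes
from is marked in both, so each intermediate sum of `i + j` copies has at least `κ` tokens there. -/
theorem reaches_interpolate {X X' : P → ℕ} {z : T → ℕ} {κ : ℕ}
    (hX' : ∀ p, (X' p : ℤ) = X p + ∑ t, N.incidence p t * (z t : ℤ))
    (hpos : ∀ t p, z t ≠ 0 → 0 < N.Pre p t → 0 < X p ∧ 0 < X' p)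
    (hκ : ∀ p, ∑ t, z t * N.Pre p t ≤ κ) (E : P → ℕ) (i j : ℕ) (hij : κ ≤ i + j) :
    N.Reaches ((i + j) • X + E) (j • X + i • X' + E) := by
  induction i generalizing j with
  | zero => simpa using Reaches.refl _
  | succ i ih =>
    have h1 := ih (j + 1) (by omega)
    rw [show i + (j + 1) = i + 1 + j by ring] at h1
    refine h1.trans (reaches_of_sum_pre_le z _ _ (fun p => ?_) fun p => ?_)
    · by_cases h0 : ∑ t, z t * N.Pre p t = 0
      · rw [h0]
        exact Nat.zero_le _
      · obtain ⟨t, -, ht⟩ := Finset.exists_ne_zero_of_sum_ne_zero h0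
        obtain ⟨hx, hx'⟩ := hpos t p (left_ne_zero_of_mul ht)
          (Nat.pos_of_ne_zero (right_ne_zero_of_mul ht))
        refine (hκ p).trans ?_
        simp only [Pi.add_apply, Pi.smul_apply, smul_eq_mul]
        have := Nat.le_mul_of_pos_right (j + 1) hx
        have := Nat.le_mul_of_pos_right i hx'
        omega
    · simp only [Pi.add_apply, Pi.smul_apply, smul_eq_mul]
      push_cast
      rw [hX' p]
      ring

end PetriNet

theorem PetriNetSystem.IsCutoff.mono {P T : Type*} {S : PetriNetSystem P T} {B B' : ℕ}
    (h : S.IsCutoff B) (hB : B ≤ B') : S.IsCutoff B' := fun n hn => h n (hB.trans hn)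

open PetriNet in
-- The remainder of `n` modulo `m₀` is corrected by `y`. The last `m₀ * γ` copies of `X` are held
-- back, so that the final vector `m₀ * γ * z + r * y` is nonnegative despite negative entries of
-- `y`. It is at most `2 * m₀ * γ * z`, hence consumes at most `2 * m₀ * γ * κ` tokens per place,
-- which the copies of `X'` already produced supply.
theorem PetriNetSystem.isCutoff_of_solution {P T : Type*} [Fintype T] (S : PetriNetSystem P T)
    (X X' : P → ℕ) (z : T → ℕ) (y : T → ℤ) (m₀ γ κ : ℕ) (hm₀ : 0 < m₀)
    (hX : S.net.Reaches (m₀ • S.source) X) (hX' : S.net.Reaches X' (m₀ • S.target))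
    (hz : ∀ p, (X' p : ℤ) = X p + ∑ t, S.net.incidence p t * (z t : ℤ))
    (hpos : ∀ t p, z t ≠ 0 → 0 < S.net.Pre p t → 0 < X p ∧ 0 < X' p)
    (hy : ∀ p, (S.target p : ℤ) = S.source p + ∑ t, S.net.incidence p t * y t)
    (hyz : ∀ t, |y t| ≤ (γ * z t : ℕ)) (hκ : ∀ p, ∑ t, z t * S.net.Pre p t ≤ κ) :
    S.IsCutoff (m₀ * (κ + m₀ * γ + 2 * m₀ * γ * κ)) := by
  intro n hn
  set m := n / m₀ with hm
  set r := n % m₀ with hr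
  have hrlt : r ≤ m₀ := (Nat.mod_lt n hm₀).le
  have hmr : n = m * m₀ + r := by rw [mul_comm]; exact (Nat.div_add_mod n m₀).symm
  have hmge : κ + m₀ * γ + 2 * m₀ * γ * κ ≤ m := by
    rw [hm, Nat.le_div_iff_mul_le hm₀, mul_comm]
    exact hn
  obtain ⟨i, hi⟩ : ∃ i, m = i + m₀ * γ := ⟨m - m₀ * γ, by omega⟩
  have hstart : S.net.Reaches (n • S.source) (m • X + r • S.source) := by
    rw [hmr, add_smul, mul_smul]
    exact (hX.nsmul m).add_right _
  have hend : S.net.Reaches (m • X' + r • S.target) (n • S.target) := by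
    rw [hmr, add_smul, mul_smul]
    exact (hX'.nsmul m).add_right _
  have hmid := reaches_interpolate hz hpos hκ (r • S.source) i (m₀ * γ) (by omega)
  rw [← hi] at hmid
  have hry : ∀ t, |(r : ℤ) * y t| ≤ (m₀ * γ * z t : ℕ) := fun t => by
    rw [abs_mul, Nat.abs_cast, mul_assoc]
    push_cast
    have := hyz t
    push_cast at this
    exact mul_le_mul (by exact_mod_cast hrlt) this (abs_nonneg _) (by positivity)
  have hz' : ∀ t, ∃ q : ℕ, (q : ℤ) = m₀ * γ * z t + r * y t ∧ q ≤ 2 * m₀ * γ * z t := fun t => by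
    have := abs_le.mp (hry t)
    push_cast at this
    refine ⟨(m₀ * γ * z t + r * y t : ℤ).toNat, Int.toNat_of_nonneg (by linarith), ?_⟩
    have h2 : (m₀ * γ * z t + r * y t : ℤ) ≤ (2 * m₀ * γ * z t : ℕ) := by
      push_cast
      linarith
    omega
  choose q hq hq2 using hz'
  refine hstart.trans (hmid.trans ((reaches_of_sum_pre_le q _ _ (fun p => ?_) fun p => ?_).trans
    hend))
  · by_cases h0 : ∑ t, q t * S.net.Pre p t = 0
    · rw [h0]
      exact Nat.zero_le _
    · obtain ⟨t, -, ht⟩ := Finset.exists_ne_zero_of_sum_ne_zero h0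
      have hzt : z t ≠ 0 := fun h => by
        have := hq2 t
        rw [h, mul_zero] at this
        exact left_ne_zero_of_mul ht (by omega)
      obtain ⟨-, hx'⟩ := hpos t p hzt (Nat.pos_of_ne_zero (right_ne_zero_of_mul ht))
      have h1 : ∑ t, q t * S.net.Pre p t ≤ 2 * m₀ * γ * κ := by
        refine le_trans ?_ (Nat.mul_le_mul_left _ (hκ p))
        rw [Finset.mul_sum]
        refine Finset.sum_le_sum fun t _ => ?_
        rw [← mul_assoc]
        exact Nat.mul_le_mul_right _ (hq2 t)
      refine h1.trans ?_
      simp only [Pi.add_apply, Pi.smul_apply, smul_eq_mul]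
      have := Nat.le_mul_of_pos_right i hx'
      omega
  · simp only [Pi.add_apply, Pi.smul_apply, smul_eq_mul]
    have h1 : ∑ t, S.net.incidence p t * (q t : ℤ) =
        m₀ * γ * ∑ t, S.net.incidence p t * (z t : ℤ) + r * ∑ t, S.net.incidence p t * y t := by
      rw [Finset.mul_sum, Finset.mul_sum, ← Finset.sum_add_distrib]
      refine Finset.sum_congr rfl fun t _ => ?_
      rw [hq]
      ring
    rw [h1, hi]
    push_cast
    rw [hz p, hy p]
    ring

/-! ### Exponential cut-offs -/

/-- A system with a cut-off has a run between positive multiples of its markings, whose support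
carries an integer solution of the marking equation. -/
theorem PetriNetSystem.AdmitsCutoff.exists_run {P T : Type*} [Fintype T] [DecidableEq T]
    {S : PetriNetSystem P T} (h : S.AdmitsCutoff) :
    ∃ (m : ℕ) (σ : List T) (y : T → ℤ), 0 < m ∧ S.net.FiresSeq σ (m • S.source) (m • S.target) ∧
      (∀ p, (S.target p : ℤ) = S.source p + ∑ t, S.net.incidence p t * y t) ∧
      ∀ t, t ∉ σ → y t = 0 := by
  obtain ⟨B, hB⟩ := h
  obtain ⟨σ, hσ⟩ := hB B le_rfl
  -- Consecutive multiples make the counts of `τ` minus those of `σ` solve the equation for `M' - M`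
  -- itself.
  obtain ⟨τ, hτ⟩ := hB (B + 1) (Nat.le_succ B)
  refine ⟨B + (B + 1), σ ++ τ, fun t => (τ.count t : ℤ) - σ.count t, by omega, ?_, fun p => ?_,
    fun t ht => ?_⟩
  · rw [add_smul B (B + 1) S.source, add_smul B (B + 1) S.target]
    refine PetriNet.firesSeq_append.mpr ⟨_, hσ.add_right _, ?_⟩
    convert hτ.add_right (B • S.target) using 1 <;> exact add_comm _ _
  · have h1 := hσ.marking_eq p
    have h2 := hτ.marking_eq p
    simp only [mul_sub, Finset.sum_sub_distrib]
    simp only [Pi.smul_apply, smul_eq_mul] at h1 h2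
    push_cast at h1 h2
    linarith
  · rw [List.mem_append, not_or] at ht
    simp [List.count_eq_zero_of_not_mem ht.1, List.count_eq_zero_of_not_mem ht.2]

open PetriNet in
-- The single number `E` dominates every intermediate quantity: `v`, `d`, `y`, the scaling factor
-- `s`, and the counts `u`, `w` spent on marking places at either end.
theorem PetriNetSystem.AdmitsCutoff.isCutoff_of_bounds {P T : Type*} [Fintype T]
    {S : PetriNetSystem P T} (h : S.AdmitsCutoff) (a E : ℕ) (ha : 1 ≤ a)
    (hPre : ∀ p t, S.net.Pre p t < a) (hPost : ∀ p t, S.net.Post p t < a)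
    (hM : ∀ p, S.source p ≤ a) (hM' : ∀ p, S.target p ≤ a) (hE : 3 ≤ E)
    (hE₁ : (a + 1) ^ Fintype.card T ≤ E) (hE₂ : Fintype.card T * a ≤ E)
    (hE₃ : (Fintype.card T + 1) * ((Fintype.card T + 1) * a) ^ (Fintype.card T + 1) +
      Fintype.card T * (Fintype.card T * a) ^ Fintype.card T ≤ E) :
    S.IsCutoff (E ^ 19) := by
  classical
  obtain ⟨m, σ, y₀, hm, hσ, hy₀, hy₀s⟩ := h.exists_run
  set N := S.net with hN
  have hinc : ∀ p t, |N.incidence p t| ≤ a := fun p t => by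
    have := hPre p t
    have := hPost p t
    rw [incidence, abs_le]
    constructor <;> omega
  have hdiff : ∀ p, |(S.target p : ℤ) - S.source p| ≤ a := fun p => by
    have := hM p
    have := hM' p
    rw [abs_le]
    constructor <;> omega
  obtain ⟨v, d, hd, hv, hvσ, hdE, hvE⟩ := exists_small_scaled_solution N.incidence
    (fun p => (S.target p : ℤ) - S.source p) a ha hinc hdiff (fun t => σ.count t) m hm (fun p => by
      have := hσ.marking_eq p
      simp only [Pi.smul_apply, smul_eq_mul] at this
      push_cast at this
      linarith)
  simp only [List.count_eq_zero] at hvσ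
  replace hdE : d ≤ E := hdE.trans (le_trans (Nat.le_add_right _ _) hE₃)
  obtain ⟨y, hy, hys, hyE⟩ := exists_small_int_solution N.incidence
    (fun p => (S.target p : ℤ) - S.source p) a ha hinc v d hd hv y₀ (fun p => by
      have := hy₀ p
      linarith)
  replace hyE : ∀ t, |y t| ≤ E := fun t =>
    (hyE t).trans (by exact_mod_cast (Nat.add_le_add_right (hvE t) _).trans hE₃)
  replace hvE : ∀ t, v t ≤ E := fun t => (hvE t).trans (le_trans (Nat.le_add_right _ _) hE₃)
  have hj : σ.toFinset.card ≤ Fintype.card T := Finset.card_le_univ _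
  obtain ⟨u, L, hL, hLu, hu0, huE, -, -, hLpos⟩ := hσ.exists_marked a hPre ha
  obtain ⟨w, L', hL', hLw, hw0, hwE, -, -, hLpos'⟩ := hσ.reverse.exists_marked a hPost ha
  rw [List.toFinset_reverse] at hL' hLw hwE
  simp only [List.mem_reverse] at hw0 hLpos'
  simp only [incidence_reverse, neg_mul, Finset.sum_neg_distrib] at hLw
  have hpowE : (a + 1) ^ σ.toFinset.card ≤ E :=
    (Nat.pow_le_pow_right (Nat.succ_pos a) hj).trans hE₁
  replace huE : ∀ t, u t ≤ E := fun t => (huE t).trans hpowE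
  replace hwE : ∀ t, w t ≤ E := fun t => (hwE t).trans hpowE
  set s := a ^ σ.toFinset.card with hs
  have hs1 : 1 ≤ s := Nat.one_le_pow _ _ ha
  have hsE : s ≤ E := (Nat.pow_le_pow_left (Nat.le_succ a) _).trans hpowE
  -- Large enough that `s * (c + 1) * v` exceeds the correction `d * (u + w)` wherever `v` is
  -- positive; hence `z` below is at least 1 on all of `σ`.
  set c := 2 * d * E with hc
  have hcE : c + 1 ≤ E ^ 3 := by
    have h1 : 2 * d * E ≤ 2 * E * E := by gcongr
    have h2 : 3 * (E * E) ≤ E * (E * E) := Nat.mul_le_mul_right _ hE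
    nlinarith
  have hzex : ∀ t, ∃ q : ℕ, (q : ℤ) = s * (c + 1) * v t - d * (u t + w t) ∧
      (t ∈ σ → 1 ≤ q) ∧ (t ∉ σ → q = 0) ∧ q ≤ E ^ 5 := fun t => by
    have hle : d * (u t + w t) ≤ c := by
      rw [hc]
      have := Nat.add_le_add (huE t) (hwE t)
      calc d * (u t + w t) ≤ d * (E + E) := Nat.mul_le_mul_left d this
        _ = 2 * d * E := by ring
    have hub : s * (c + 1) * v t ≤ E ^ 5 := by
      calc s * (c + 1) * v t ≤ E * E ^ 3 * E := by gcongr; exact hvE t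
        _ = E ^ 5 := by ring
    by_cases ht : t ∈ σ
    · have hv1 : 1 ≤ v t := Nat.pos_of_ne_zero fun h0 => (hvσ t).mp h0 ht
      have hge : c + 1 ≤ s * (c + 1) * v t := by
        calc c + 1 = 1 * (c + 1) * 1 := by ring
          _ ≤ s * (c + 1) * v t := by gcongr
      refine ⟨s * (c + 1) * v t - d * (u t + w t), ?_, fun _ => by omega,
        fun h' => absurd ht h', (Nat.sub_le _ _).trans hub⟩
      rw [Nat.cast_sub (by omega)]
      push_cast
      ring
    · have hv0 : v t = 0 := (hvσ t).mpr ht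
      refine ⟨0, ?_, fun h' => absurd h' ht, fun _ => rfl, Nat.zero_le _⟩
      simp [hv0, hu0 t ht, hw0 t ht]
  choose z hz hz1 hz0 hzE using hzex
  -- Of the `s * d * (c + 1)` copies of a marking, `d` batches of `s` are used to mark places and
  -- the rest are left untouched.
  have hsplit : ∀ M : P → ℕ, (s * d * (c + 1)) • M = (s * d * c) • M + d • (s • M) := fun M => by
    rw [← mul_smul, ← add_smul]
    congr 1
    ring
  have hfinal := S.isCutoff_of_solution ((s * d * c) • S.source + d • L)
    ((s * d * c) • S.target + d • L') z y (s * d * (c + 1)) E (Fintype.card T * a * E ^ 5)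
    (by positivity)
    (by
      rw [hsplit]
      exact (Reaches.refl _).add (hL.nsmul d))
    (by
      rw [hsplit]
      exact (Reaches.refl _).add (hL'.of_reverse.nsmul d))
    (fun p => by
      have h1 : ∑ t, N.incidence p t * (z t : ℤ) =
          s * (c + 1) * ∑ t, N.incidence p t * (v t : ℤ) -
          d * (∑ t, N.incidence p t * (u t : ℤ) + ∑ t, N.incidence p t * (w t : ℤ)) := by
        rw [← Finset.sum_add_distrib, Finset.mul_sum, Finset.mul_sum, ← Finset.sum_sub_distrib]
        refine Finset.sum_congr rfl fun t _ => ?_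
        rw [hz]
        ring
      have h2 := hLu p
      have h3 := hLw p
      rw [← hN, h1, hv p]
      simp only [Pi.add_apply, Pi.smul_apply, smul_eq_mul]
      push_cast at h2 h3 ⊢
      rw [h2, h3]
      ring)
    (fun t p hzt hpre => by
      have ht : t ∈ σ := by
        by_contra h'
        exact hzt (hz0 t h')
      have h1 := Nat.mul_pos hd (hLpos t ht p (Or.inl hpre))
      have h2 := Nat.mul_pos hd (hLpos' t ht p (Or.inr hpre))
      simp only [Pi.add_apply, Pi.smul_apply, smul_eq_mul]
      omega)
    (fun p => by
      rw [← hN, hy p]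
      ring)
    (fun t => by
      by_cases ht : t ∈ σ
      · refine (hyE t).trans ?_
        exact_mod_cast Nat.le_mul_of_pos_right E (hz1 t ht)
      · rw [hys t ((hvσ t).mpr ht) (hy₀s t ht)]
        simp only [abs_zero]
        positivity)
    (fun p => by
      refine (Finset.sum_le_card_nsmul _ _ (E ^ 5 * a) fun t _ =>
        Nat.mul_le_mul (hzE t) (hPre p t).le).trans (le_of_eq ?_)
      rw [Finset.card_univ, smul_eq_mul]
      ring)
  refine hfinal.mono ?_
  have hm₀ : s * d * (c + 1) ≤ E ^ 5 := by
    calc s * d * (c + 1) ≤ E * E * E ^ 3 := by gcongr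
      _ = E ^ 5 := by ring
  have hκ : Fintype.card T * a * E ^ 5 ≤ E ^ 6 := by
    calc Fintype.card T * a * E ^ 5 ≤ E * E ^ 5 := by gcongr
      _ = E ^ 6 := by ring
  generalize s * d * (c + 1) = m₀ at hm₀
  generalize Fintype.card T * a * E ^ 5 = κ at hκ
  calc m₀ * (κ + m₀ * E + 2 * m₀ * E * κ)
      ≤ E ^ 5 * (E ^ 6 + E ^ 5 * E + 2 * E ^ 5 * E * E ^ 6) := by gcongr
    _ = E ^ 11 * 2 + 2 * E ^ 17 := by ring
    _ ≤ E ^ 17 * 2 + 2 * E ^ 17 := by gcongr <;> omega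
    _ = 4 * E ^ 17 := by ring
    _ ≤ E ^ 2 * E ^ 17 := Nat.mul_le_mul_right _ (by nlinarith)
    _ = E ^ 19 := by ring

/-- Take `E = 2 ^ (3 * (n + 1) ^ 2)`; then `57 = 3 * 19` comes from `E ^ 19`. -/
theorem PetriNetSystem.AdmitsCutoff.isCutoff_two_pow {P T : Type*} [Fintype T]
    {S : PetriNetSystem P T} (h : S.AdmitsCutoff) (n : ℕ) (hT : Fintype.card T ≤ n)
    (hPre : ∀ p t, S.net.Pre p t < 2 ^ n) (hPost : ∀ p t, S.net.Post p t < 2 ^ n)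
    (hM : ∀ p, S.source p ≤ 2 ^ n) (hM' : ∀ p, S.target p ≤ 2 ^ n) :
    S.IsCutoff (2 ^ (57 * (n + 1) ^ 2)) := by
  set k := Fintype.card T with hk
  have h1 : n + 1 ≤ 2 ^ n := Nat.lt_two_pow_self
  have h2 : 1 ≤ 2 ^ n := Nat.one_le_two_pow
  have hbase : (k + 1) * 2 ^ n ≤ 2 ^ (2 * n) := by
    calc (k + 1) * 2 ^ n ≤ 2 ^ n * 2 ^ n := Nat.mul_le_mul_right _ (by omega)
      _ = 2 ^ (2 * n) := by rw [← pow_add]; congr 1; ring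
  have hbase' : k * 2 ^ n ≤ 2 ^ (2 * n) := (Nat.mul_le_mul_right _ (Nat.le_succ k)).trans hbase
  have := h.isCutoff_of_bounds (2 ^ n) (2 ^ (3 * (n + 1) ^ 2)) h2 hPre hPost hM hM' ?_ ?_ ?_ ?_
  · rw [← pow_mul] at this
    convert this using 2
    ring
  · calc 3 ≤ 2 ^ 3 := by norm_num
      _ ≤ 2 ^ (3 * (n + 1) ^ 2) := Nat.pow_le_pow_right two_pos (by nlinarith)
  · calc (2 ^ n + 1) ^ k ≤ (2 ^ (n + 1)) ^ n := by
          refine (Nat.pow_le_pow_left ?_ _).trans (Nat.pow_le_pow_right (by positivity) hT)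
          rw [pow_succ]
          omega
      _ = 2 ^ ((n + 1) * n) := (pow_mul _ _ _).symm
      _ ≤ 2 ^ (3 * (n + 1) ^ 2) := Nat.pow_le_pow_right two_pos (by nlinarith)
  · exact hbase'.trans (Nat.pow_le_pow_right two_pos (by nlinarith))
  · calc (k + 1) * ((k + 1) * 2 ^ n) ^ (k + 1) + k * (k * 2 ^ n) ^ k
        ≤ 2 ^ n * (2 ^ (2 * n)) ^ (n + 1) + 2 ^ n * (2 ^ (2 * n)) ^ (n + 1) := by
          have h3 : 1 ≤ 2 ^ (2 * n) := Nat.one_le_two_pow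
          refine Nat.add_le_add (Nat.mul_le_mul (by omega) ?_) (Nat.mul_le_mul (by omega) ?_)
          · exact (Nat.pow_le_pow_left hbase _).trans (Nat.pow_le_pow_right h3 (by omega))
          · exact (Nat.pow_le_pow_left hbase' _).trans (Nat.pow_le_pow_right h3 (by omega))
      _ = 2 ^ (n + 2 * n * (n + 1) + 1) := by
          rw [← pow_mul, ← pow_add, pow_succ]
          ring
      _ ≤ 2 ^ (3 * (n + 1) ^ 2) := Nat.pow_le_pow_right two_pos (by nlinarith)

/-! ### Bounds in terms of the encoding sizes -/

theorem length_binaryCode (n : ℕ) : (binaryCode n).length = 2 * n.size + 1 := by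
  rw [← Nat.size_eq_bits_len]
  simp [binaryCode, List.length_flatMap, mul_comm]

theorem lt_two_pow_length_matrixCode {P T : Type*} [Fintype P] [Fintype T] (B : Matrix P T ℕ)
    (p : P) (t : T) : B p t < 2 ^ (matrixCode B).length := by
  refine Nat.lt_size_self (B p t) |>.trans_le (Nat.pow_le_pow_right two_pos ?_)
  have h : (binaryCode (B p t)).length ≤ (matrixCode B).length := by
    refine ((List.sublist_flatten_of_mem ?_).trans
      (List.sublist_flatten_of_mem (List.mem_ofFn.mpr ⟨Fintype.equivFin P p, rfl⟩))).length_le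
    exact List.mem_ofFn.mpr ⟨Fintype.equivFin T t, by simp⟩
  rw [length_binaryCode] at h
  omega

theorem PetriNet.size_eq {P T : Type*} [Fintype P] [Fintype T] (N : PetriNet P T) :
    N.size = (Fintype.card P + 1) + (Fintype.card T + 1) + (matrixCode N.Pre).length +
      (matrixCode N.Post).length := by
  simp [PetriNet.size, PetriNet.encode, unaryCode]
  ring

theorem le_two_pow_size_markingSize {P : Type*} [Fintype P] (M : P → ℕ) (p : P) :
    M p ≤ 2 ^ (markingSize M).size :=
  (Finset.single_le_sum (f := M) (fun _ _ => Nat.zero_le _) (Finset.mem_univ p)).trans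
    (Nat.lt_size_self _).le

theorem markingSize_eq_zero {P : Type*} [Fintype P] {M : P → ℕ} (h : markingSize M = 0) :
    M = 0 :=
  funext fun p => Finset.sum_eq_zero_iff.mp h p (Finset.mem_univ p)

theorem PetriNetSystem.AdmitsCutoff.isCutoff_param {P T : Type*} [Fintype P] [Fintype T]
    {S : PetriNetSystem P T} (h : S.AdmitsCutoff) :
    S.IsCutoff (2 ^ (57 * (S.param + 1) ^ 2)) := by
  have hsize := S.net.size_eq
  -- Distinct markings are not both zero, so neither factor of `S.param` vanishes and each is
  -- bounded by the product.
  have hpos : 0 < (markingSize S.source).size + (markingSize S.target).size := by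
    by_contra h0
    have h1 : (markingSize S.source).size = 0 := by omega
    have h2 : (markingSize S.target).size = 0 := by omega
    rw [Nat.size_eq_zero] at h1 h2
    exact S.source_ne_target ((markingSize_eq_zero h1).trans (markingSize_eq_zero h2).symm)
  have hnet : S.net.size ≤ S.param := Nat.le_mul_of_pos_right _ hpos
  have hmark : (markingSize S.source).size + (markingSize S.target).size ≤ S.param :=
    Nat.le_mul_of_pos_left _ (by omega)
  refine h.isCutoff_two_pow S.param (by omega) (fun p t => ?_) (fun p t => ?_) (fun p => ?_)
    fun p => ?_
  · exact (lt_two_pow_length_matrixCode _ p t).trans_le (Nat.pow_le_pow_right two_pos (by omega))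
  · exact (lt_two_pow_length_matrixCode _ p t).trans_le (Nat.pow_le_pow_right two_pos (by omega))
  · exact (le_two_pow_size_markingSize _ p).trans (Nat.pow_le_pow_right two_pos (by omega))
  · exact (le_two_pow_size_markingSize _ p).trans (Nat.pow_le_pow_right two_pos (by omega))

/-! ### Rendez-vous protocols as Petri nets -/

namespace RVProtocol

variable {Q A : Type*} (V : RVProtocol Q A)

/-- The rendez-vous of a protocol: a sending and a receiving rule with the same letter. -/
def RendezVous : Type _ :=
  {x : V.rules × V.rules // ∃ a, x.1.1.2.1 = RVAction.send a ∧ x.2.1.2.1 = RVAction.recv a}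

open Classical in
noncomputable instance : Fintype V.RendezVous :=
  inferInstanceAs (Fintype {x : V.rules × V.rules //
    ∃ a, x.1.1.2.1 = RVAction.send a ∧ x.2.1.2.1 = RVAction.recv a})

open Classical in
theorem card_rendezVous_le : Fintype.card V.RendezVous ≤ V.rules.card ^ 2 := by
  refine (Fintype.card_subtype_le _).trans ?_
  rw [Fintype.card_prod, Fintype.card_coe, sq]

open Classical in
/-- The Petri net of a protocol, whose places are the states. -/
noncomputable def toPetriNet : PetriNet Q V.RendezVous where
  Pre s x := (Pi.single x.1.1.1.1 1 + Pi.single x.1.2.1.1 1 : Q → ℕ) s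
  Post s x := (Pi.single x.1.1.1.2.2 1 + Pi.single x.1.2.1.2.2 1 : Q → ℕ) s

theorem step_iff_exists_fires (C C' : Q → ℕ) :
    V.Step C C' ↔ ∃ x, V.toPetriNet.Fires x C C' := by
  have key : ∀ D E : Q → ℕ, (∀ s, D s ≤ C s ∧ (C' s : ℤ) = C s + ((E s : ℤ) - D s)) ↔
      D ≤ C ∧ C' = C - D + E := fun D E => by
    constructor
    · intro h
      refine ⟨fun s => (h s).1, funext fun s => ?_⟩
      have := h s
      simp only [Pi.add_apply, Pi.sub_apply]
      omega
    · rintro ⟨h1, rfl⟩ s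
      have : D s ≤ C s := h1 s
      simp only [Pi.add_apply, Pi.sub_apply]
      omega
  constructor
  · rintro ⟨a, p, q, p', q', hp, hq, h⟩
    refine ⟨⟨(⟨_, hp⟩, ⟨_, hq⟩), a, rfl, rfl⟩, (key _ _).mpr h⟩
  · rintro ⟨⟨⟨⟨⟨p, b, p'⟩, hp⟩, ⟨⟨q, c, q'⟩, hq⟩⟩, a, hb, hc⟩, h⟩
    obtain rfl : b = _ := hb
    obtain rfl : c = _ := hc
    refine ⟨a, p, q, p', q', hp, hq, (key _ _).mp h⟩

theorem reaches_iff (C C' : Q → ℕ) : V.Reaches C C' ↔ V.toPetriNet.Reaches C C' := by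
  constructor
  · intro h
    induction h with
    | refl => exact PetriNet.Reaches.refl _
    | tail _ h ih =>
      obtain ⟨x, hx⟩ := (V.step_iff_exists_fires _ _).mp h
      exact ih.trans hx.reaches
  · rintro ⟨σ, hσ⟩
    induction σ generalizing C with
    | nil =>
      cases (show C = C' from hσ)
      exact Relation.ReflTransGen.refl
    | cons x σ ih =>
      obtain ⟨L, hL, h⟩ := hσ
      exact Relation.ReflTransGen.head ((V.step_iff_exists_fires _ _).mpr ⟨x, hL⟩) (ih L h)

/-- The Petri net system of a protocol whose initial and final states differ. -/
noncomputable def toPetriNetSystem (h : V.init ≠ V.fin) : PetriNetSystem Q V.RendezVous where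
  net := V.toPetriNet
  source := V.initConfig 1
  target := V.finConfig 1
  source_ne_target he := by
    have := congrFun he V.init
    simp [initConfig, finConfig, h] at this

theorem isCutoff_iff (h : V.init ≠ V.fin) (B : ℕ) :
    V.IsCutoff B ↔ (V.toPetriNetSystem h).IsCutoff B := by
  have h1 : ∀ n, n • V.initConfig 1 = V.initConfig n := fun n => by
    simp [initConfig, ← Pi.single_smul]
  have h2 : ∀ n, n • V.finConfig 1 = V.finConfig n := fun n => by
    simp [finConfig, ← Pi.single_smul]
  refine forall_congr' fun n => forall_congr' fun _ => ?_
  rw [reaches_iff]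
  simp only [toPetriNetSystem, h1, h2]

variable [Fintype Q] [Fintype A]

/-- Each rule takes at least its action bit; the 3 counts the two unary end markers and one bit for
a state, as `init` exists. -/
theorem card_rules_add_three_le_size : V.rules.card + 3 ≤ V.size := by
  have hQ : 0 < Fintype.card Q := Fintype.card_pos_iff.mpr ⟨V.init⟩
  have hrule : ∀ r : Q × RVAction A × Q, 1 ≤ (ruleCode r).length := by
    rintro ⟨p, a | a, q⟩ <;> simp [ruleCode] <;> omega
  have hflat : ∀ l : List (Q × RVAction A × Q), l.length ≤ (l.flatMap ruleCode).length := by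
    intro l
    induction l with
    | nil => simp
    | cons r l ih =>
      have := hrule r
      simp only [List.flatMap_cons, List.length_append, List.length_cons]
      omega
  have := hflat V.rules.toList
  rw [Finset.length_toList] at this
  simp only [size, encode, unaryCode, List.length_append, List.length_replicate,
    List.length_singleton]
  omega

theorem AdmitsCutoff.isCutoff_two_pow {V : RVProtocol Q A} (h : V.AdmitsCutoff) :
    V.IsCutoff (2 ^ (V.size ^ 10)) := by
  classical
  -- A Petri net system requires distinct markings, so this case is separate; no step is needed in
  -- it.
  by_cases hne : V.init = V.fin
  · intro n _
    have : V.initConfig n = V.finConfig n := by rw [initConfig, finConfig, hne]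
    rw [this]
    exact Relation.ReflTransGen.refl
  have hsize := V.card_rules_add_three_le_size
  have hcard : Fintype.card V.RendezVous ≤ V.size ^ 2 :=
    V.card_rendezVous_le.trans (Nat.pow_le_pow_left (by omega) 2)
  set m := V.size
  have hm : 3 ≤ m := by omega
  have h4 : 2 < 2 ^ (m ^ 2) := by
    calc 2 < 2 ^ 2 := by norm_num
      _ ≤ 2 ^ (m ^ 2) := Nat.pow_le_pow_right two_pos (by nlinarith)
  have hsingle : ∀ p q : Q, (Pi.single p 1 : Q → ℕ) q ≤ 1 := fun p q => by
    rw [Pi.single_apply]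
    split_ifs <;> omega
  have hadm : (V.toPetriNetSystem hne).AdmitsCutoff := by
    obtain ⟨B, hB⟩ := h
    exact ⟨B, (V.isCutoff_iff hne B).mp hB⟩
  rw [V.isCutoff_iff hne]
  refine (hadm.isCutoff_two_pow (m ^ 2) hcard (fun p t => ?_) (fun p t => ?_) (fun p => ?_)
    fun p => ?_).mono (Nat.pow_le_pow_right two_pos ?_)
  · refine lt_of_le_of_lt ?_ h4
    exact Nat.add_le_add (hsingle _ p) (hsingle _ p)
  · refine lt_of_le_of_lt ?_ h4
    exact Nat.add_le_add (hsingle _ p) (hsingle _ p)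
  · refine le_trans ?_ (one_lt_two.trans h4).le
    exact hsingle _ p
  · refine le_trans ?_ (one_lt_two.trans h4).le
    exact hsingle _ p
  · have h5 : m ^ 2 + 1 ≤ m ^ 3 := by
      have : 3 * m ^ 2 ≤ m * m ^ 2 := Nat.mul_le_mul_right _ hm
      nlinarith
    -- The exponent 10 arises from `57 ≤ 3 ^ 4 ≤ m ^ 4` and `m ^ 2 + 1 ≤ m ^ 3`, both using `3 ≤ m`.
    calc 57 * (m ^ 2 + 1) ^ 2 ≤ 3 ^ 4 * (m ^ 3) ^ 2 := by gcongr; norm_num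
      _ ≤ m ^ 4 * (m ^ 3) ^ 2 := by gcongr
      _ = m ^ 10 := by ring

end RVProtocol

theorem mainTheorem5 :
    (∃ f : Polynomial ℕ, ∀ (P T : Type*) [Fintype P] [Fintype T] (S : PetriNetSystem P T),
      S.AdmitsCutoff → ∃ B : ℕ, S.IsCutoff B ∧ B.size ≤ f.eval S.param) ∧
    (∃ k : ℕ, ∀ (Q A : Type*) [Fintype Q] [Fintype A] (V : RVProtocol Q A),
      V.AdmitsCutoff → ∃ B : ℕ, V.IsCutoff B ∧ B ≤ 2 ^ (V.size ^ k)) := by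
  refine ⟨⟨57 * (Polynomial.X + 1) ^ 2 + 1, fun P T _ _ S h => ⟨_, h.isCutoff_param, ?_⟩⟩,
    10, fun Q A _ _ V h => ⟨_, h.isCutoff_two_pow, le_rfl⟩⟩
  -- A power `2 ^ e` has `e + 1` binary digits, whence the final `+ 1` in the polynomial.
  rw [Nat.size_pow]
  simp
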